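/- Throughout, $X_t=\xi+W_t$, where $W$ is a standard Brownian motion and $\xi$ is a real random variable independent of $W$, and stopping times refer to the augmented filtration, i.e. the one generated by $\xi$, by $W_s$, $s\le t$, and by the null sets. A boundary together with an initial state $\xi$ is said to embed a law $\mu$ on $\mathbb{R}$ if the corresponding first hitting time $\tau$ of $X$ is an almost surely finite stopping time and $X_\tau$ has law $\mu$; it solves the Skorohod embedding problem for $\mu$ if, moreover, $\mathbb{E}[\tau]<\infty$. The first hitting times are as follows (with $\inf\emptyset=\infty$): - for the line $b_+(t)=k_+t$ with $k_+>0$: $\tau_+=\inf\{t\ge 0: X_t<k_+t\}$; - for the line $b_-(t)=k_-t$ with $k_-<0$: $\tau_-=\inf\{t\ge 0: X_t>k_-t\}$; - for the wedge boundary $b_+\cup b_-$: $\tau=\inf\{t\ge 0: k_-t<X_t<k_+t\}$, the first time at which $X$ enters the wedge between the two lines. **Proposition.** Let $\mu$ be a probability measure on $\mathbb{R}$, $p_+=\mu([0,\infty))$, $p_-=1-p_+$, and write $\mu=p_+\mu_++p_-\mu_-$, where $\mu_+$ is a probability measure on $[0,\infty)$ and $\mu_-$ is a probability measure on $(-\infty,0)$.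 Let $k_+>0>k_-$, and suppose that the initial state $\xi_+$ with the boundary $b_+(t)=k_+t$ embeds $\mu_+$ and that the initial state $\xi_-$ with the boundary $b_-(t)=k_-t$ embeds $\mu_-$. Let $\xi$ be equal to $\xi_+$ with probability $p_+$ and to $\xi_-$ with probability $p_-$, that is, let the law of $\xi$ be $p_+\,\mathrm{Law}(\xi_+)+p_-\,\mathrm{Law}(\xi_-)$. Then the initial state $\xi$ with the wedge boundary $b_+\cup b_-$ embeds $\mu$. If, moreover, $\xi_\pm$ with $b_\pm$ solve the Skorohod embedding problem for $\mu_\pm$ (that is, the two hitting times are integrable), then $\xi$ with $b_+\cup b_-$ solves the Skorohod embedding problem for $\mu$. -/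

import Mathlib

open MeasureTheory ProbabilityTheory
open scoped NNReal ENNReal

namespace SkorohodWedge

variable {Ω : Type*} {mΩ : MeasurableSpace Ω}

/-- `W` is a standard Brownian motion under `P` (so that `P` is a probability measure) and `ξ` is a
real random variable independent of the whole process `W`. -/
structure IsStartedBrownian (ξ : Ω → ℝ) (W : ℝ≥0 → Ω → ℝ) (P : Measure Ω) : Prop where
  brownian : IsBrownianReal W P
  aemeasurable_start : AEMeasurable ξ P
  indep : IndepFun ξ (fun ω t ↦ W t ω) P

/-- The Brownian motion `X_t = ξ + W_t` with random initial state `ξ`. -/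
def started (ξ : Ω → ℝ) (W : ℝ≥0 → Ω → ℝ) : ℝ≥0 → Ω → ℝ := fun t ω ↦ ξ ω + W t ω

/-- The sigma-algebra generated by `ξ` and by `W_s`, `s ≤ t`. -/
abbrev rawPast (ξ : Ω → ℝ) (W : ℝ≥0 → Ω → ℝ) (t : ℝ≥0) : MeasurableSpace Ω :=
  MeasurableSpace.comap ξ inferInstance ⊔
    ⨆ s : Set.Iic t, MeasurableSpace.comap (W s) inferInstance

theorem comap_le_completion {P : Measure Ω} {f : Ω → ℝ} (hf : AEMeasurable f P) :
    MeasurableSpace.comap f inferInstance ≤ eventuallyMeasurableSpace mΩ (ae P) := by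
  rintro _ ⟨s, hs, rfl⟩
  exact hf.nullMeasurable hs

/-- The augmented filtration: the sigma-algebra generated by `ξ` and by `W_s`, `s ≤ t`, together
with all `P`-null sets. (The ambient sigma-algebra is the `P`-completion of the given one.) -/
def augFiltration {ξ : Ω → ℝ} {W : ℝ≥0 → Ω → ℝ} {P : Measure Ω} (h : IsStartedBrownian ξ W P) :
    Filtration ℝ≥0 (eventuallyMeasurableSpace mΩ (ae P)) where
  seq t := eventuallyMeasurableSpace (rawPast ξ W t) (ae P)
  mono' := by
    rintro s t hst A ⟨B, hB, hAB⟩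
    refine ⟨B, ?_, hAB⟩
    have hle : rawPast ξ W s ≤ rawPast ξ W t := by
      refine sup_le_sup le_rfl (iSup_le fun u ↦ ?_)
      exact le_iSup (fun v : Set.Iic t ↦ MeasurableSpace.comap (W v) inferInstance)
        ⟨u.1, le_trans u.2 hst⟩
    exact hle _ hB
  le' := by
    rintro t A ⟨B, hB, hAB⟩
    have hle : rawPast ξ W t ≤ eventuallyMeasurableSpace mΩ (ae P) :=
      sup_le (comap_le_completion h.aemeasurable_start)
        (iSup_le fun u ↦ comap_le_completion (h.brownian.aemeasurable u.1))
    obtain ⟨C, hC, hBC⟩ := hle _ hB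
    exact ⟨C, hC, hAB.trans hBC⟩

/-- The first time at which the space-time process `(t, X_t)` is in the region `D`
(`⊤` if this never happens). -/
noncomputable def hitTime (X : ℝ≥0 → Ω → ℝ) (D : Set (ℝ≥0 × ℝ)) : Ω → WithTop ℝ≥0 :=
  hittingAfter (fun t ω ↦ (t, X t ω)) D 0

/-- The region below the line `x = k t`: the line is crossed from above. -/
def below (k : ℝ) : Set (ℝ≥0 × ℝ) := {z | z.2 < k * z.1}

/-- The region above the line `x = k t`: the line is crossed from below. -/
def above (k : ℝ) : Set (ℝ≥0 × ℝ) := {z | k * z.1 < z.2}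

/-- The wedge bounded by the two half-lines `x = k₋ t` and `x = k₊ t`, `t ≥ 0`. -/
def wedge (kp km : ℝ) : Set (ℝ≥0 × ℝ) := {z | km * z.1 < z.2 ∧ z.2 < kp * z.1}

/-- The first hitting time of `D` by `X = ξ + W` embeds the law `μ`: it is a stopping time of the
augmented filtration, it is almost surely finite, and `X` stopped at that time has law `μ`. -/
structure Embeds {ξ : Ω → ℝ} {W : ℝ≥0 → Ω → ℝ} {P : Measure Ω} (h : IsStartedBrownian ξ W P)
    (D : Set (ℝ≥0 × ℝ)) (μ : Measure ℝ) : Prop where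
  isStoppingTime : IsStoppingTime (augFiltration h) (hitTime (started ξ W) D)
  ae_finite : ∀ᵐ ω ∂P, hitTime (started ξ W) D ω ≠ ⊤
  hasLaw : HasLaw (stoppedValue (started ξ W) (hitTime (started ξ W) D)) μ P

/-- The initial state `ξ` and the boundary of `D` solve the Skorohod embedding problem for the law
`μ`: the first hitting time of `D` by `X = ξ + W` embeds `μ` and is integrable. -/
structure SolvesSkorohod {ξ : Ω → ℝ} {W : ℝ≥0 → Ω → ℝ} {P : Measure Ω}
    (h : IsStartedBrownian ξ W P) (D : Set (ℝ≥0 × ℝ)) (μ : Measure ℝ) : Prop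
    extends Embeds h D μ where
  integrable : Integrable (fun ω ↦ (((hitTime (started ξ W) D ω).untopD 0 : ℝ≥0) : ℝ)) P

end SkorohodWedge

/-! A continuous path started at or above zero cannot get below the lower line without first
crossing zero, and at positive times zero lies inside the wedge. So the wedge is hit exactly when
the upper line is (`hitTime_wedge_eq_below`); a start at zero is covered because Brownian motion
returns to zero at arbitrarily small times (`ae_exists_zero_lt`). The other side follows by
reflection. The starts have the right sign because a path started on the wrong side of its line
stops at once, outside the support of the target.

It remains to mix. The three processes may live on different spaces, so everything passes through
the law of the path at rational times. By independence this law is affine in the law of the initial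
state (`map_sampledPath_mixture`), while the hitting time and the stopped position are measurable
functionals of that path (`sampledHitTime`, `sampledValue`). Finiteness, the stopped law and the
mean hitting time therefore all mix.

For the stopping time property, the path almost surely avoids both lines at a fixed positive time,
so up to null sets the past decides whether the wedge has been reached. -/

open Filter Topology

namespace SkorohodWedge

/-! ### Oscillation of Brownian motion at large and small times -/

section Oscillation

variable {Ω : Type*} {mΩ : MeasurableSpace Ω} {B : ℝ≥0 → Ω → ℝ} {P : Measure Ω}

/-- The probability that an increment of a pre-Brownian motion exceeds its standard deviation. -/
lemma measure_sqrt_sub_lt_increment (hB : IsPreBrownianReal B P) {s t : ℝ≥0} (hst : s < t) :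
    P {ω | √(t - s) < B t ω - B s ω} = gaussianReal 0 1 (Set.Ioi 1) := by
  have hpos : (0 : ℝ) < t - s := sub_pos.2 (by exact_mod_cast hst)
  have hlaw := (hB.hasLaw_sub t s)
  have hlaw' := gaussianReal_const_mul hlaw (√(t - s : ℝ))⁻¹
  have hvar : (.mk ((√(t - s : ℝ))⁻¹ ^ 2) (sq_nonneg _) : ℝ≥0) * nndist t.1 s.1 = 1 := by
    apply NNReal.eq
    rw [NNReal.coe_mul, NNReal.coe_mk, coe_nndist, Real.dist_eq, NNReal.coe_one]
    change (√(t - s : ℝ))⁻¹ ^ 2 * |(t : ℝ) - s| = 1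
    rw [abs_of_pos hpos, inv_pow, Real.sq_sqrt hpos.le, inv_mul_cancel₀ hpos.ne']
  rw [mul_zero, hvar] at hlaw'
  have := hlaw'.measure_eq (p := fun x ↦ 1 < x) measurableSet_Ioi
  refine Eq.trans ?_ this
  congr 1
  ext ω
  have : 0 < √(t - s : ℝ) := Real.sqrt_pos.2 hpos
  simp only [Set.mem_ofPred_eq, Pi.sub_apply]
  rw [← div_eq_inv_mul, one_lt_div this]

lemma measure_sqrt_le_abs_eval_le (hB : IsPreBrownianReal B P) (s : ℝ≥0) {c : ℝ} (hc : 0 < c) :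
    P {ω | √c ≤ |B s ω|} ≤ ENNReal.ofReal (s / c) := by
  have := hB.isGaussianProcess.isProbabilityMeasure
  have h := meas_ge_le_variance_div_sq
    (hB.isGaussianProcess.hasGaussianLaw_eval s).memLp_two (Real.sqrt_pos.2 hc)
  rw [hB.integral_eval, ← covariance_self (hB.aemeasurable s), hB.covariance_eval, min_self,
    Real.sq_sqrt hc.le] at h
  simpa using h

/-- The times grow so fast that the increment over one step dominates the value before it.
Infinitely often the increment exceeds its standard deviation, while eventually the earlier value
stays below that level. -/
lemma ae_frequently_pos_of_measurable (hB : IsPreBrownianReal B P) (hm : ∀ t, Measurable (B t)) :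
    ∀ᵐ ω ∂P, ∃ᶠ n : ℕ in atTop, 0 < B (2 ^ (n ^ 2)) ω := by
  have := hB.isGaussianProcess.isProbabilityMeasure
  set t : ℕ → ℝ≥0 := fun n ↦ 2 ^ (n ^ 2) with ht
  have ht_succ (n : ℕ) : t (n + 1) = 2 ^ n * 2 ^ (n + 1) * t n := by
    simp only [ht, ← pow_add]; ring_nf
  have ht_pos (n : ℕ) : 0 < t n := by positivity
  have ht_gap (n : ℕ) : (2 : ℝ) ^ n * t n ≤ t (n + 1) - t n := by
    rw [ht_succ]
    push_cast
    have h1 : (1 : ℝ) ≤ 2 ^ n := one_le_pow₀ (by norm_num)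
    have h2 : (0 : ℝ) < t n := ht_pos n
    rw [pow_succ]
    nlinarith [mul_pos (zero_lt_one.trans_le h1) h2, mul_le_mul_of_nonneg_right h1 h2.le,
      mul_le_mul_of_nonneg_right h1 (mul_pos (zero_lt_one.trans_le h1) h2).le]
  have ht_lt (n : ℕ) : t n < t (n + 1) := by
    have h2 : (0 : ℝ) < t n := ht_pos n
    have : (0 : ℝ) < t (n + 1) - t n := lt_of_lt_of_le (by positivity) (ht_gap n)
    exact_mod_cast sub_pos.1 this
  have ht_mono : Monotone t := monotone_nat_of_le_succ fun n ↦ (ht_lt n).le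
  let A : ℕ → Set Ω := fun n ↦ {ω | √(t (n + 1) - t n) < B (t (n + 1)) ω - B (t n) ω}
  have hA_meas (n : ℕ) : MeasurableSet (A n) :=
    measurableSet_lt measurable_const ((hm _).sub (hm _))
  have hA_indep : iIndepSet A P := by
    have h := hB.hasIndepIncrements.nat ht_mono
    refine (iIndepSet_iff_meas_biInter hA_meas).2 fun S ↦ ?_
    exact h.measure_inter_preimage_eq_mul S
      (sets := fun n ↦ Set.Ioi (√(t (n + 1) - t n : ℝ))) fun n _ ↦ measurableSet_Ioi
  have hA_io : ∀ᵐ ω ∂P, ∃ᶠ n in atTop, ω ∈ A n := by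
    have h1 : P (limsup A atTop) = 1 := by
      refine measure_limsup_eq_one hA_meas hA_indep ?_
      have hA (n : ℕ) : P (A n) = gaussianReal 0 1 (Set.Ioi 1) :=
        measure_sqrt_sub_lt_increment hB (ht_lt n)
      simp_rw [hA]
      -- Were the Gaussian tail null, Lebesgue measure would vanish on `Set.Ioi 1`.
      refine ENNReal.tsum_const_eq_top_of_ne_zero fun h0 ↦ ?_
      have := (gaussianReal_absolutelyContinuous' 0 one_ne_zero) h0
      simp at this
    have h2 : ∀ᵐ ω ∂P, ω ∈ limsup A atTop := by
      rw [← mem_ae_iff_prob_eq_one (MeasurableSet.measurableSet_limsup hA_meas)] at h1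
      exact h1
    filter_upwards [h2] with ω hω using mem_limsup_iff_frequently_mem.1 hω
  -- First Borel–Cantelli lemma: Chebyshev and `ht_gap` bound the probabilities by a geometric
  -- series.
  have hsmall : ∀ᵐ ω ∂P, ∀ᶠ n in atTop, ω ∉ {ω | √(t (n + 1) - t n) ≤ |B (t n) ω|} := by
    refine ae_eventually_notMem (ne_top_of_le_ne_top (b := ∑' n : ℕ, (2⁻¹ : ℝ≥0∞) ^ n)
      (by simp [ENNReal.tsum_geometric]) (ENNReal.tsum_le_tsum fun n ↦ ?_))
    have h2 : (0 : ℝ) < t n := ht_pos n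
    have hgap : (0 : ℝ) < t (n + 1) - t n := lt_of_lt_of_le (by positivity) (ht_gap n)
    refine (measure_sqrt_le_abs_eval_le hB (t n) hgap).trans ?_
    have : (t n : ℝ) / (t (n + 1) - t n) ≤ (2⁻¹ : ℝ) ^ n := by
      rw [div_le_iff₀ hgap, inv_pow, ← div_eq_inv_mul, le_div_iff₀ (by positivity), mul_comm]
      exact ht_gap n
    refine (ENNReal.ofReal_le_ofReal this).trans_eq ?_
    rw [ENNReal.ofReal_pow (by norm_num), ENNReal.ofReal_inv_of_pos (by norm_num)]
    simp
  filter_upwards [hA_io, hsmall] with ω h1 h2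
  have h3 : ∃ᶠ n in atTop, 0 < B (t (n + 1)) ω := by
    refine (h1.and_eventually h2).mono fun n hn ↦ ?_
    obtain ⟨ha, hb⟩ := hn
    simp only [A, Set.mem_ofPred_eq, not_le] at ha hb
    linarith [neg_abs_le (B (t n) ω)]
  exact (tendsto_add_atTop_nat 1).frequently h3

/-- A pre-Brownian motion is positive at arbitrarily large times. -/
lemma ae_frequently_pos (hB : IsPreBrownianReal B P) :
    ∀ᵐ ω ∂P, ∃ᶠ n : ℕ in atTop, 0 < B (2 ^ (n ^ 2)) ω := by
  have hB' : IsPreBrownianReal (fun t ↦ (hB.aemeasurable t).mk) P :=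
    hB.congr fun t ↦ (hB.aemeasurable t).ae_eq_mk
  have heq : ∀ᵐ ω ∂P, ∀ n : ℕ, B (2 ^ (n ^ 2)) ω = (hB.aemeasurable (2 ^ (n ^ 2))).mk _ ω :=
    ae_all_iff.2 fun n ↦ (hB.aemeasurable _).ae_eq_mk
  filter_upwards [ae_frequently_pos_of_measurable hB' fun t ↦ (hB.aemeasurable t).measurable_mk,
    heq] with ω h1 h2
  exact h1.mono fun n hn ↦ by rwa [h2 n]

/-- A pre-Brownian motion is positive at arbitrarily small positive times. -/
lemma ae_exists_pos_lt (hB : IsPreBrownianReal B P) :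
    ∀ᵐ ω ∂P, ∀ ε : ℝ≥0, 0 < ε → ∃ t, 0 < t ∧ t < ε ∧ 0 < B t ω := by
  -- Time inversion carries large times to small ones.
  filter_upwards [ae_frequently_pos hB.inv] with ω hω ε hε
  have hlim : Tendsto (fun n : ℕ ↦ 1 / (2 : ℝ≥0) ^ (n ^ 2)) atTop (𝓝 0) := by
    have h1 : Tendsto (fun n : ℕ ↦ (1 / 2 : ℝ≥0) ^ n) atTop (𝓝 0) :=
      NNReal.tendsto_pow_atTop_nhds_zero_of_lt_one (NNReal.half_lt_self one_ne_zero)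
    simpa [Function.comp_def] using h1.comp (tendsto_pow_atTop two_ne_zero)
  obtain ⟨n, hn, hlt⟩ := (hω.and_eventually (hlim.eventually_lt_const hε)).exists
  refine ⟨_, by positivity, hlt, ?_⟩
  exact pos_of_mul_pos_right hn (by positivity)

/-- A Brownian motion returns to zero at arbitrarily small positive times. -/
lemma ae_exists_zero_lt (hB : IsBrownianReal B P) :
    ∀ᵐ ω ∂P, ∀ ε : ℝ≥0, 0 < ε → ∃ t, 0 < t ∧ t < ε ∧ B t ω = 0 := by
  filter_upwards [ae_exists_pos_lt hB.toIsPreBrownianReal,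
    ae_exists_pos_lt hB.toIsPreBrownianReal.neg, hB.cont] with ω hpos hneg hc ε hε
  obtain ⟨s, hs0, hs, hBs⟩ := hpos ε hε
  obtain ⟨t, ht0, ht, hBt⟩ := hneg ε hε
  have hBt : B t ω < 0 := by simpa using hBt
  have h := intermediate_value_uIcc (a := s) (b := t) (f := fun u ↦ B u ω) hc.continuousOn
  obtain ⟨u, hu, hu0⟩ := h (Set.mem_uIcc.2 (.inr ⟨hBt.le, hBs.le⟩))
  rcases Set.mem_uIcc.1 hu with ⟨h1, h2⟩ | ⟨h1, h2⟩
  · exact ⟨u, hs0.trans_le h1, h2.trans_lt ht, hu0⟩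
  · exact ⟨u, ht0.trans_le h1, h2.trans_lt hs, hu0⟩

end Oscillation

/-! ### Pathwise comparison and sampling of hitting times -/

section Hitting

variable {Ω : Type*} {X : ℝ≥0 → Ω → ℝ} {D D' : Set (ℝ≥0 × ℝ)} {ω : Ω}

lemma hitTime_lt_iff {t : ℝ≥0} : hitTime X D ω < t ↔ ∃ s < t, (s, X s ω) ∈ D := by
  rw [hitTime, hittingAfter_lt_iff]
  simp

lemma hitTime_le_of_mem {t : ℝ≥0} (h : (t, X t ω) ∈ D) : hitTime X D ω ≤ t :=
  hittingAfter_le_of_mem (zero_le) h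

/-- The regions are open, so the infimum is usually not attained; the comparison goes through a
level strictly between the two times. -/
lemma hitTime_le_hitTime {Y : ℝ≥0 → Ω → ℝ}
    (H : ∀ s, (s, X s ω) ∈ D → ∃ u ≤ s, (u, Y u ω) ∈ D') :
    hitTime Y D' ω ≤ hitTime X D ω := by
  by_contra! hlt
  obtain ⟨r, h1, h2⟩ := WithTop.lt_iff_exists_coe_btwn.1 hlt
  obtain ⟨s, hs, hD⟩ := hitTime_lt_iff.1 h1
  obtain ⟨u, hu, hD'⟩ := H s hD
  exact h2.not_ge ((hitTime_le_of_mem hD').trans (WithTop.coe_le_coe.2 (hu.trans hs.le)))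

lemma isOpen_below (k : ℝ) : IsOpen (below k) :=
  isOpen_lt (by fun_prop) (by fun_prop)

lemma isOpen_above (k : ℝ) : IsOpen (above k) :=
  isOpen_lt (by fun_prop) (by fun_prop)

lemma isOpen_wedge (kp km : ℝ) : IsOpen (wedge kp km) :=
  (isOpen_above km).inter (isOpen_below kp)

lemma zero_mem_wedge {kp km : ℝ} (hkp : 0 < kp) (hkm : km < 0) {t : ℝ≥0} (ht : 0 < t) :
    (t, (0 : ℝ)) ∈ wedge kp km := by
  have : (0 : ℝ) < t := ht
  exact ⟨by simpa using mul_neg_of_neg_of_pos hkm this, by simpa using mul_pos hkp this⟩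

lemma hitTime_wedge_eq_below {kp km : ℝ} (hkp : 0 < kp) (hkm : km < 0)
    (hc : Continuous (X · ω)) (h0 : 0 ≤ X 0 ω)
    (hz : X 0 ω = 0 → ∀ ε : ℝ≥0, 0 < ε → ∃ t, 0 < t ∧ t < ε ∧ X t ω = 0) :
    hitTime X (wedge kp km) ω = hitTime X (below kp) ω := by
  refine le_antisymm (hitTime_le_hitTime fun s hs ↦ ?_)
    (hitTime_le_hitTime fun s hs ↦ ⟨s, le_rfl, hs.2⟩)
  have hs : X s ω < kp * s := hs
  have hs0 : 0 < s := by
    rcases eq_zero_or_pos s with rfl | h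
    · simp at hs
      linarith
    · exact h
  by_cases hsm : km * s < X s ω
  · exact ⟨s, le_rfl, hsm, hs⟩
  obtain h0 | h0 := h0.eq_or_lt
  · obtain ⟨u, hu0, hu, hXu⟩ := hz h0.symm s hs0
    exact ⟨u, hu.le, by simpa [hXu] using zero_mem_wedge hkp hkm hu0⟩
  · have hXs : X s ω ≤ 0 :=
      (not_lt.1 hsm).trans (mul_nonpos_of_nonpos_of_nonneg hkm.le s.2)
    obtain ⟨u, hu, hXu⟩ := intermediate_value_Icc' hs0.le (f := fun u ↦ X u ω)
      hc.continuousOn ⟨hXs, h0.le⟩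
    have hXu : X u ω = 0 := hXu
    have hu0 : 0 < u := by
      rcases eq_zero_or_pos u with rfl | h
      · exact absurd hXu h0.ne'
      · exact h
    exact ⟨u, hu.2, by simpa [hXu] using zero_mem_wedge hkp hkm hu0⟩

lemma hitTime_neg {k : ℝ} : hitTime (-X) (below (-k)) ω = hitTime X (above k) ω := by
  apply le_antisymm <;> refine hitTime_le_hitTime fun s hs ↦ ⟨s, le_rfl, ?_⟩ <;>
    simpa [below, above] using hs

lemma hitTime_neg_wedge {kp km : ℝ} :
    hitTime (-X) (wedge (-km) (-kp)) ω = hitTime X (wedge kp km) ω := by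
  apply le_antisymm <;> refine hitTime_le_hitTime fun s hs ↦ ⟨s, le_rfl, ?_⟩ <;>
    simpa [wedge, and_comm] using hs

lemma hitTime_wedge_eq_above {kp km : ℝ} (hkp : 0 < kp) (hkm : km < 0)
    (hc : Continuous (X · ω)) (h0 : X 0 ω ≤ 0)
    (hz : X 0 ω = 0 → ∀ ε : ℝ≥0, 0 < ε → ∃ t, 0 < t ∧ t < ε ∧ X t ω = 0) :
    hitTime X (wedge kp km) ω = hitTime X (above km) ω := by
  rw [← hitTime_neg_wedge, ← hitTime_neg]
  refine hitTime_wedge_eq_below (neg_pos.2 hkm) (neg_lt_zero.2 hkp) hc.neg ?_ ?_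
  · simpa using h0
  · simpa using hz

lemma exists_nnrat_lt_mem (hc : Continuous (X · ω)) (hD : IsOpen D) {s t : ℝ≥0} (hst : s < t)
    (hs : (s, X s ω) ∈ D) : ∃ q : ℚ≥0, (q : ℝ≥0) < t ∧ ((q : ℝ≥0), X q ω) ∈ D := by
  have hopen : IsOpen {u : ℝ≥0 | u < t ∧ (u, X u ω) ∈ D} :=
    isOpen_Iio.inter (hD.preimage (by fun_prop))
  obtain ⟨u, hsu, hu⟩ := exists_Ico_subset_of_mem_nhds (hopen.mem_nhds ⟨hst, hs⟩) ⟨t, hst⟩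
  obtain ⟨q, hq0, hsq, hqu⟩ := NNReal.lt_iff_exists_rat_btwn s u |>.1 hsu
  lift q to ℚ≥0 using hq0
  have hq : Real.toNNReal ((q : ℚ) : ℝ) = (q : ℝ≥0) := by
    apply NNReal.eq
    rw [Real.coe_toNNReal _ (by positivity)]
    push_cast
    rfl
  rw [hq] at hsq hqu
  exact ⟨q, hu ⟨hsq.le, hqu⟩⟩

/-- The first hitting time of `D`, as a function of the path at rational times. -/
noncomputable def sampledHitTime (D : Set (ℝ≥0 × ℝ)) (y : ℚ≥0 → ℝ) : ℝ≥0∞ :=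
  ⨅ q : ℚ≥0, ⨅ _ : ((q : ℝ≥0), y q) ∈ D, ((q : ℝ≥0) : ℝ≥0∞)

/-- The position at the first hitting time of `D`, as a function of the path at rational times:
the limit of the positions at rational times that decrease to the hitting time. -/
noncomputable def sampledValue (D : Set (ℝ≥0 × ℝ)) (y : ℚ≥0 → ℝ) : ℝ :=
  limsup (fun n : ℕ ↦ y ((⌊(n + 1) * (sampledHitTime D y).toReal⌋₊ + 1 : ℚ≥0) / (n + 1))) atTop

lemma measurable_sampledHitTime (hD : MeasurableSet D) : Measurable (sampledHitTime D) := by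
  classical
  refine .iInf fun q ↦ ?_
  simp_rw [iInf_eq_if]
  exact .ite (hD.preimage (by fun_prop)) measurable_const measurable_const

lemma measurable_sampledValue (hD : MeasurableSet D) : Measurable (sampledValue D) := by
  refine .limsup fun n ↦ ?_
  -- Evaluation at a random index is measurable because the index is countable.
  have h1 : Measurable fun z : (ℚ≥0 → ℝ) × ℕ ↦ z.1 ((z.2 + 1 : ℚ≥0) / (n + 1)) :=
    measurable_from_prod_countable_left fun k ↦
      measurable_pi_apply (((k : ℚ≥0) + 1) / (n + 1))
  have h2 : Measurable fun y : ℚ≥0 → ℝ ↦ ⌊(n + 1) * (sampledHitTime D y).toReal⌋₊ :=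
    Nat.measurable_floor.comp (measurable_const.mul (measurable_sampledHitTime hD).ennreal_toReal)
  exact h1.comp (measurable_id.prodMk h2)

lemma hitTime_eq_sampledHitTime (hc : Continuous (X · ω)) (hD : IsOpen D) :
    hitTime X D ω = sampledHitTime D (fun q ↦ X q ω) := by
  apply le_antisymm
  · exact le_iInf₂ fun q hq ↦ hitTime_le_of_mem hq
  · by_contra hlt
    obtain ⟨r, h1, h2⟩ := ENNReal.lt_iff_exists_nnreal_btwn.1 (lt_of_not_ge hlt)
    obtain ⟨s, hs, hsD⟩ := hitTime_lt_iff.1 h1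
    obtain ⟨q, hq, hqD⟩ := exists_nnrat_lt_mem hc hD hs hsD
    have h3 : sampledHitTime D (fun q ↦ X q ω) ≤ ((q : ℝ≥0) : ℝ≥0∞) := iInf₂_le q hqD
    exact h2.not_ge (h3.trans (WithTop.coe_le_coe.2 hq.le))

lemma tendsto_floor_add_one_div (a : ℝ≥0) :
    Tendsto (fun n : ℕ ↦ (((⌊(n + 1) * (a : ℝ)⌋₊ + 1 : ℚ≥0) / (n + 1) : ℚ≥0) : ℝ≥0))
      atTop (𝓝 a) := by
  rw [← NNReal.tendsto_coe]
  have h : Tendsto (fun n : ℕ ↦ (a : ℝ) + 1 / ((n : ℝ) + 1)) atTop (𝓝 (a + 0)) :=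
    tendsto_one_div_add_atTop_nhds_zero_nat.const_add _
  rw [add_zero] at h
  refine tendsto_of_tendsto_of_tendsto_of_le_of_le tendsto_const_nhds h (fun n ↦ ?_) fun n ↦ ?_
  · have := (Nat.lt_floor_add_one ((n + 1) * (a : ℝ))).le
    push_cast
    rw [le_div_iff₀ (by positivity)]
    linarith
  · have := Nat.floor_le (a := (n + 1) * (a : ℝ)) (by positivity)
    have hn : (0 : ℝ) < n + 1 := by positivity
    push_cast
    rw [div_le_iff₀ hn, add_mul _ _ ((n : ℝ) + 1), one_div, inv_mul_cancel₀ hn.ne']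
    linarith

/-- Continuity makes the limsup a genuine limit. Finiteness matters, as `toReal` sends `⊤` to zero.
-/
lemma stoppedValue_eq_sampledValue (hc : Continuous (X · ω)) (hD : IsOpen D)
    (hfin : hitTime X D ω ≠ ⊤) :
    stoppedValue X (hitTime X D) ω = sampledValue D (fun q ↦ X q ω) := by
  obtain ⟨a, ha⟩ := WithTop.ne_top_iff_exists.1 hfin
  have hs : sampledHitTime D (fun q ↦ X q ω) = (a : ℝ≥0∞) :=
    (hitTime_eq_sampledHitTime hc hD).symm.trans ha.symm
  have ha' : (a : WithTop ℝ≥0).untopA = a := rfl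
  rw [stoppedValue, ← ha, ha', sampledValue, hs, ENNReal.coe_toReal]
  exact ((hc.tendsto a).comp (tendsto_floor_add_one_div a)).limsup_eq.symm

end Hitting

/-! ### Path laws, the stopping time property and transfer between spaces -/

section Started

variable {Ω : Type*} {mΩ : MeasurableSpace Ω} {ξ : Ω → ℝ} {W : ℝ≥0 → Ω → ℝ} {P : Measure Ω}

/-- The path of `X = ξ + W` at rational times. -/
def sampledPath (ξ : Ω → ℝ) (W : ℝ≥0 → Ω → ℝ) (ω : Ω) : ℚ≥0 → ℝ := fun q ↦ started ξ W q ω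

lemma IsStartedBrownian.isProbabilityMeasure (h : IsStartedBrownian ξ W P) :
    IsProbabilityMeasure P :=
  (h.brownian.hasLaw_eval 0).isProbabilityMeasure

lemma IsStartedBrownian.ae_continuous (h : IsStartedBrownian ξ W P) :
    ∀ᵐ ω ∂P, Continuous (started ξ W · ω) := by
  filter_upwards [h.brownian.cont] with ω hω
  exact continuous_const.add hω

lemma IsStartedBrownian.ae_started_zero (h : IsStartedBrownian ξ W P) :
    ∀ᵐ ω ∂P, started ξ W 0 ω = ξ ω := by
  filter_upwards [h.brownian.eval_zero_ae_eq_zero] with ω hω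
  simp [started, hω]

lemma IsStartedBrownian.ae_exists_zero_lt (h : IsStartedBrownian ξ W P) :
    ∀ᵐ ω ∂P, started ξ W 0 ω = 0 →
      ∀ ε : ℝ≥0, 0 < ε → ∃ t, 0 < t ∧ t < ε ∧ started ξ W t ω = 0 := by
  filter_upwards [h.ae_started_zero, SkorohodWedge.ae_exists_zero_lt h.brownian]
    with ω h0 hω hξ ε hε
  obtain ⟨t, ht0, ht, hWt⟩ := hω ε hε
  exact ⟨t, ht0, ht, by rw [started, ← h0, hξ, hWt, add_zero]⟩

lemma IsStartedBrownian.aemeasurable_sampledPath (h : IsStartedBrownian ξ W P) :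
    AEMeasurable (sampledPath ξ W) P :=
  aemeasurable_pi_lambda _ fun q ↦ h.aemeasurable_start.add (h.brownian.aemeasurable q)

/-- The law of a Brownian motion at rational times does not depend on the Brownian motion. -/
lemma map_restrict_nnrat_eq {Ω' : Type*} {mΩ' : MeasurableSpace Ω'} {P' : Measure Ω'}
    {W' : ℝ≥0 → Ω' → ℝ} (hW : IsPreBrownianReal W P) (hW' : IsPreBrownianReal W' P') :
    P.map (fun ω (q : ℚ≥0) ↦ W q ω) = P'.map (fun ω (q : ℚ≥0) ↦ W' q ω) := by
  have := hW.isGaussianProcess.isProbabilityMeasure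
  have := hW'.isGaussianProcess.isProbabilityMeasure
  have key (I : Finset ℚ≥0) : P.map (fun ω ↦ I.restrict fun q : ℚ≥0 ↦ W q ω) =
      P'.map (fun ω ↦ I.restrict fun q : ℚ≥0 ↦ W' q ω) := by
    classical
    let J : Finset ℝ≥0 := I.image (fun q : ℚ≥0 ↦ (q : ℝ≥0))
    let f : (J → ℝ) → (I → ℝ) := fun x i ↦ x ⟨(i.1 : ℝ≥0), Finset.mem_image_of_mem _ i.2⟩
    have hf : Measurable f := by fun_prop
    have h1 := (hW.hasLaw J)
    have h2 := (hW'.hasLaw J)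
    have e1 : P.map (fun ω ↦ I.restrict fun q : ℚ≥0 ↦ W q ω) =
        (P.map (fun ω ↦ J.restrict (W · ω))).map f := by
      rw [AEMeasurable.map_map_of_aemeasurable hf.aemeasurable h1.aemeasurable]
      rfl
    have e2 : P'.map (fun ω ↦ I.restrict fun q : ℚ≥0 ↦ W' q ω) =
        (P'.map (fun ω ↦ J.restrict (W' · ω))).map f := by
      rw [AEMeasurable.map_map_of_aemeasurable hf.aemeasurable h2.aemeasurable]
      rfl
    rw [e1, e2, h1.map_eq, h2.map_eq]
  -- Equal finite-dimensional laws force equal projective limits.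
  have l1 := isProjectiveLimit_map (P := P) (X := fun (q : ℚ≥0) ω ↦ W q ω)
    (aemeasurable_pi_lambda _ fun q ↦ hW.aemeasurable q)
  have l2 := isProjectiveLimit_map (P := P') (X := fun (q : ℚ≥0) ω ↦ W' q ω)
    (aemeasurable_pi_lambda _ fun q ↦ hW'.aemeasurable q)
  simp_rw [key] at l1
  exact l1.unique l2

lemma IsStartedBrownian.map_sampledPath (h : IsStartedBrownian ξ W P) :
    P.map (sampledPath ξ W) = ((P.map ξ).prod (P.map fun ω (q : ℚ≥0) ↦ W q ω)).map
      fun z q ↦ z.1 + z.2 q := by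
  have := h.isProbabilityMeasure
  have hW : AEMeasurable (fun ω (q : ℚ≥0) ↦ W q ω) P :=
    aemeasurable_pi_lambda _ fun q ↦ h.brownian.aemeasurable q
  have hres : Measurable fun (w : ℝ≥0 → ℝ) (q : ℚ≥0) ↦ w (q : ℝ≥0) := by fun_prop
  have hind : IndepFun ξ (fun ω (q : ℚ≥0) ↦ W q ω) P := h.indep.comp measurable_id hres
  rw [← hind.map_prod_eq_prod_map_map h.aemeasurable_start hW,
    AEMeasurable.map_map_of_aemeasurable (by fun_prop) (h.aemeasurable_start.prodMk hW)]
  rfl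

/-- A mixture of initial states yields the mixture of the laws of the paths. -/
lemma IsStartedBrownian.map_sampledPath_mixture {Ωp Ωm : Type*} {mΩp : MeasurableSpace Ωp}
    {mΩm : MeasurableSpace Ωm} {Pp : Measure Ωp} {Pm : Measure Ωm}
    {ξp : Ωp → ℝ} {Wp : ℝ≥0 → Ωp → ℝ} {ξm : Ωm → ℝ} {Wm : ℝ≥0 → Ωm → ℝ}
    (h : IsStartedBrownian ξ W P) (hp : IsStartedBrownian ξp Wp Pp)
    (hm : IsStartedBrownian ξm Wm Pm) {a b : ℝ≥0∞}
    (hξ : P.map ξ = a • Pp.map ξp + b • Pm.map ξm) :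
    P.map (sampledPath ξ W) =
      a • Pp.map (sampledPath ξp Wp) + b • Pm.map (sampledPath ξm Wm) := by
  have := h.isProbabilityMeasure
  have := hp.isProbabilityMeasure
  have := hm.isProbabilityMeasure
  rw [h.map_sampledPath, hp.map_sampledPath, hm.map_sampledPath, hξ,
    map_restrict_nnrat_eq hp.brownian.toIsPreBrownianReal h.brownian.toIsPreBrownianReal,
    map_restrict_nnrat_eq hm.brownian.toIsPreBrownianReal h.brownian.toIsPreBrownianReal,
    Measure.add_prod, Measure.prod_smul_left, Measure.prod_smul_left,
    Measure.map_add _ _ (by fun_prop), Measure.map_smul, Measure.map_smul]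

/-- By independence and Fubini, it suffices that a Gaussian of positive variance has no atoms. -/
lemma IsStartedBrownian.ae_started_ne (h : IsStartedBrownian ξ W P) {t : ℝ≥0} (ht : 0 < t)
    (c : ℝ) : ∀ᵐ ω ∂P, started ξ W t ω ≠ c := by
  have := h.isProbabilityMeasure
  have hWt := h.brownian.hasLaw_eval t
  have hind : IndepFun ξ (W t) P := h.indep.comp measurable_id (measurable_pi_apply t)
  have hlaw := hind.map_prod_eq_prod_map_map h.aemeasurable_start hWt.aemeasurable
  rw [hWt.map_eq] at hlaw
  have := nullSingletonClass_gaussianReal (μ := 0) ht.ne'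
  have hmeas : MeasurableSet {z : ℝ × ℝ | z.1 + z.2 = c} :=
    measurableSet_eq_fun (by fun_prop) measurable_const
  have hnull : ((P.map ξ).prod (gaussianReal 0 t)) {z | z.1 + z.2 = c} = 0 := by
    rw [Measure.measure_prod_null hmeas]
    refine .of_forall fun x ↦ ?_
    have : Prod.mk x ⁻¹' {z : ℝ × ℝ | z.1 + z.2 = c} = {c - x} := by
      ext y
      simp [eq_sub_iff_add_eq, add_comm]
    simp [this]
  rw [← hlaw, Measure.map_apply_of_aemeasurable
    (h.aemeasurable_start.prodMk hWt.aemeasurable) hmeas] at hnull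
  rw [ae_iff]
  simpa [started] using hnull

/-- The time slices of the wedge shrink to zero, away from the start. -/
lemma hitTime_wedge_pos {X : ℝ≥0 → Ω → ℝ} {ω : Ω} {kp km : ℝ} (hc : Continuous (X · ω))
    (h0 : X 0 ω ≠ 0) : 0 < hitTime X (wedge kp km) ω := by
  have hlim : Tendsto (fun t : ℝ≥0 ↦ X t ω) (𝓝 0) (𝓝 (X 0 ω)) := hc.tendsto 0
  have hlin (k : ℝ) : Tendsto (fun t : ℝ≥0 ↦ k * (t : ℝ)) (𝓝 0) (𝓝 0) := by
    have : Continuous fun t : ℝ≥0 ↦ k * (t : ℝ) := by fun_prop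
    simpa using this.tendsto 0
  have hev : ∀ᶠ t : ℝ≥0 in 𝓝 0, (t, X t ω) ∉ wedge kp km := by
    rcases h0.lt_or_gt with h | h
    · filter_upwards [hlim.eventually_lt (hlin km) h] with t ht hw
      exact lt_asymm ht hw.1
    · filter_upwards [(hlin kp).eventually_lt hlim h] with t ht hw
      exact lt_asymm ht hw.2
  obtain ⟨u, hu, hsub⟩ := exists_Ico_subset_of_mem_nhds hev ⟨1, zero_lt_one⟩
  refine lt_of_lt_of_le (WithTop.coe_pos.2 hu) (not_lt.1 fun hlt ↦ ?_)
  obtain ⟨s, hs, hsD⟩ := hitTime_lt_iff.1 hlt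
  exact hsub ⟨zero_le, hs⟩ hsD

lemma IsStartedBrownian.hitTime_wedge_le_zero_iff (h : IsStartedBrownian ξ W P) {kp km : ℝ}
    (hkp : 0 < kp) (hkm : km < 0) :
    ∀ᵐ ω ∂P, hitTime (started ξ W) (wedge kp km) ω ≤ (0 : ℝ≥0) ↔ ξ ω = 0 := by
  filter_upwards [h.ae_continuous, h.ae_started_zero, h.ae_exists_zero_lt] with ω hc h0 hz
  refine ⟨fun hle ↦ ?_, fun hξ ↦ ?_⟩
  · by_contra hξ
    exact (hitTime_wedge_pos hc (h0 ▸ hξ)).not_ge hle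
  · by_contra! hlt
    obtain ⟨r, h1, h2⟩ := WithTop.lt_iff_exists_coe_btwn.1 hlt
    obtain ⟨t, ht0, ht, hXt⟩ := hz (h0.trans hξ) r (WithTop.coe_lt_coe.1 h1)
    have hle : hitTime (started ξ W) (wedge kp km) ω ≤ t :=
      hitTime_le_of_mem (by simpa [hXt] using zero_mem_wedge hkp hkm ht0)
    exact h2.not_ge (hle.trans (WithTop.coe_le_coe.2 ht.le))

/-- At a fixed positive time at which the path is not on the boundary of the wedge, having reached
the wedge is visible from the path at earlier rational times. -/
lemma hitTime_wedge_le_iff {X : ℝ≥0 → Ω → ℝ} {ω : Ω} {kp km : ℝ} {t : ℝ≥0}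
    (hc : Continuous (X · ω)) (ht : 0 < t) (hp : X t ω ≠ kp * t) (hm : X t ω ≠ km * t) :
    hitTime X (wedge kp km) ω ≤ t ↔
      ∃ q : ℚ≥0, (q : ℝ≥0) < t ∧ ((q : ℝ≥0), X q ω) ∈ wedge kp km := by
  refine ⟨fun hle ↦ ?_, fun ⟨q, hq, hqD⟩ ↦
    (hitTime_le_of_mem hqD).trans (WithTop.coe_le_coe.2 hq.le)⟩
  have hlin (k : ℝ) : Continuous fun s : ℝ≥0 ↦ k * (s : ℝ) := by fun_prop
  suffices ∃ s < t, (s, X s ω) ∈ wedge kp km by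
    obtain ⟨s, hs, hsD⟩ := this
    exact exists_nnrat_lt_mem hc (isOpen_wedge kp km) hs hsD
  by_cases hw : (t, X t ω) ∈ wedge kp km
  · have hopen : {s : ℝ≥0 | (s, X s ω) ∈ wedge kp km} ∈ 𝓝 t :=
      ((isOpen_wedge kp km).preimage (by fun_prop)).mem_nhds hw
    obtain ⟨l, hl, hsub⟩ := exists_Ioc_subset_of_mem_nhds hopen ⟨0, ht⟩
    obtain ⟨s, hls, hst⟩ := exists_between hl
    exact ⟨s, hst, hsub ⟨hls, hst.le⟩⟩
  · have hev : ∀ᶠ s in 𝓝 t, (s, X s ω) ∉ wedge kp km := by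
      by_cases h1 : km * t < X t ω
      · have h2 : kp * t < X t ω := lt_of_le_of_ne (not_lt.1 fun h ↦ hw ⟨h1, h⟩) hp.symm
        filter_upwards [((hlin kp).tendsto t).eventually_lt (hc.tendsto t) h2] with s hs hD
        exact lt_asymm hs hD.2
      · have h2 : X t ω < km * t := lt_of_le_of_ne (not_lt.1 h1) hm
        filter_upwards [(hc.tendsto t).eventually_lt ((hlin km).tendsto t) h2] with s hs hD
        exact lt_asymm hs hD.1
    -- The path stays outside the wedge for a while after `t`, so the visit must come before `t`.
    obtain ⟨u, hu, hsub⟩ := exists_Ico_subset_of_mem_nhds hev ⟨t + 1, lt_add_one t⟩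
    obtain ⟨s, hs, hsD⟩ := hitTime_lt_iff.1 (hle.trans_lt (WithTop.coe_lt_coe.2 hu))
    refine ⟨s, not_le.1 fun hts ↦ hsub ⟨hts, hs⟩ hsD, hsD⟩

/-- Entering an open region by time `t` would ordinarily require a glimpse beyond `t`. Here that
matters only on a null set, which the augmentation absorbs; at time zero the event is almost surely
`ξ = 0`. -/
lemma IsStartedBrownian.isStoppingTime_hitTime_wedge (h : IsStartedBrownian ξ W P) {kp km : ℝ}
    (hkp : 0 < kp) (hkm : km < 0) :
    IsStoppingTime (augFiltration h) (hitTime (started ξ W) (wedge kp km)) := by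
  intro t
  have hξ : @Measurable _ _ (rawPast ξ W t) _ ξ :=
    (comap_measurable ξ).mono le_sup_left le_rfl
  rcases eq_zero_or_pos t with rfl | ht
  · refine ⟨{ω | ξ ω = 0}, hξ (measurableSet_singleton 0), ?_⟩
    exact eventuallyEq_set.2 (h.hitTime_wedge_le_zero_iff hkp hkm)
  · refine ⟨⋃ q : ℚ≥0, ⋃ _ : (q : ℝ≥0) < t,
      {ω | ((q : ℝ≥0), started ξ W q ω) ∈ wedge kp km}, ?_, ?_⟩
    · refine MeasurableSet.iUnion fun q ↦ MeasurableSet.iUnion fun hq ↦ ?_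
      have hW : @Measurable _ _ (rawPast ξ W t) _ (W q) :=
        (comap_measurable (W q)).mono ((le_iSup (fun s : Set.Iic t ↦
          MeasurableSpace.comap (W s) inferInstance) ⟨q, hq.le⟩).trans le_sup_right) le_rfl
      exact (measurable_const.prodMk (hξ.add hW)) (isOpen_wedge kp km).measurableSet
    · refine eventuallyEq_set.2 ?_
      filter_upwards [h.ae_continuous, h.ae_started_ne ht (kp * t), h.ae_started_ne ht (km * t)]
        with ω hc hp hm
      refine (hitTime_wedge_le_iff hc ht hp hm).trans ?_
      simp

lemma IsStartedBrownian.hitTime_ae_eq (h : IsStartedBrownian ξ W P) {D : Set (ℝ≥0 × ℝ)}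
    (hD : IsOpen D) :
    ∀ᵐ ω ∂P, hitTime (started ξ W) D ω = sampledHitTime D (sampledPath ξ W ω) := by
  filter_upwards [h.ae_continuous] with ω hc
  exact hitTime_eq_sampledHitTime hc hD

/-- If the hitting time of `D` is finite, the stopped position is almost surely a measurable
function of the path at rational times. -/
lemma IsStartedBrownian.stoppedValue_ae_eq (h : IsStartedBrownian ξ W P) {D : Set (ℝ≥0 × ℝ)}
    (hD : IsOpen D) (hfin : ∀ᵐ ω ∂P, hitTime (started ξ W) D ω ≠ ⊤) :
    stoppedValue (started ξ W) (hitTime (started ξ W) D) =ᵐ[P]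
      fun ω ↦ sampledValue D (sampledPath ξ W ω) := by
  filter_upwards [h.ae_continuous, hfin] with ω hc hω
  exact stoppedValue_eq_sampledValue hc hD hω

lemma IsStartedBrownian.ae_finite_iff (h : IsStartedBrownian ξ W P) {D : Set (ℝ≥0 × ℝ)}
    (hD : IsOpen D) :
    (∀ᵐ ω ∂P, hitTime (started ξ W) D ω ≠ ⊤) ↔
      ∀ᵐ y ∂P.map (sampledPath ξ W), sampledHitTime D y ≠ ⊤ := by
  have hms : MeasurableSet {y | sampledHitTime D y ≠ ⊤} :=
    (measurable_sampledHitTime hD.measurableSet) (measurableSet_singleton ⊤).compl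
  rw [ae_map_iff h.aemeasurable_sampledPath hms]
  refine eventually_congr ?_
  filter_upwards [h.hitTime_ae_eq hD] with ω hω
  rw [hω]
  rfl

/-- The right-hand side is additive in the path law. `hfin` is essential, since `untopD 0` would
hide infinite times. -/
lemma IsStartedBrownian.integrable_hitTime_iff (h : IsStartedBrownian ξ W P)
    {D : Set (ℝ≥0 × ℝ)} (hD : IsOpen D) (hfin : ∀ᵐ ω ∂P, hitTime (started ξ W) D ω ≠ ⊤) :
    Integrable (fun ω ↦ (((hitTime (started ξ W) D ω).untopD 0 : ℝ≥0) : ℝ)) P ↔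
      ∫⁻ y, sampledHitTime D y ∂P.map (sampledPath ξ W) ≠ ⊤ := by
  have hm := measurable_sampledHitTime hD.measurableSet
  have heq : (fun ω ↦ (((hitTime (started ξ W) D ω).untopD 0 : ℝ≥0) : ℝ)) =ᵐ[P]
      fun ω ↦ (sampledHitTime D (sampledPath ξ W ω)).toReal := by
    filter_upwards [h.hitTime_ae_eq hD] with ω hω
    rw [hω]
    rfl
  rw [integrable_congr heq, lintegral_map' hm.aemeasurable h.aemeasurable_sampledPath]
  refine integrable_toReal_iff (hm.comp_aemeasurable h.aemeasurable_sampledPath) ?_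
  filter_upwards [h.hitTime_ae_eq hD, hfin] with ω hω hne
  rwa [hω] at hne

/-- A negative start lies below the line already at time zero, so it would be its own stopped value.
-/
lemma IsStartedBrownian.ae_nonneg_of_embeds_below (h : IsStartedBrownian ξ W P) {k : ℝ}
    {μ : Measure ℝ} (hμ : μ (Set.Iio 0) = 0) (he : Embeds h (below k) μ) :
    ∀ᵐ ω ∂P, 0 ≤ ξ ω := by
  have hpos : ∀ᵐ ω ∂P, 0 ≤ stoppedValue (started ξ W) (hitTime (started ξ W) (below k)) ω := by
    have h1 : ∀ᵐ x ∂μ, (0 : ℝ) ≤ x := by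
      rw [ae_iff]
      simpa [Set.Iio] using hμ
    rw [← he.hasLaw.map_eq] at h1
    exact ae_of_ae_map he.hasLaw.aemeasurable h1
  filter_upwards [hpos, h.ae_started_zero] with ω hω h0
  by_contra! hneg
  have hle : hitTime (started ξ W) (below k) ω ≤ (0 : ℝ≥0) :=
    hitTime_le_of_mem (by simpa [below, h0] using hneg)
  have hz : hitTime (started ξ W) (below k) ω = (0 : ℝ≥0) := le_antisymm hle bot_le
  rw [stoppedValue, hz] at hω
  exact hω.not_gt (by simpa [h0] using hneg)

lemma IsStartedBrownian.ae_nonpos_of_embeds_above (h : IsStartedBrownian ξ W P) {k : ℝ}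
    {μ : Measure ℝ} (hμ : μ (Set.Ici 0) = 0) (he : Embeds h (above k) μ) :
    ∀ᵐ ω ∂P, ξ ω ≤ 0 := by
  have hneg : ∀ᵐ ω ∂P, stoppedValue (started ξ W) (hitTime (started ξ W) (above k)) ω < 0 := by
    have h1 : ∀ᵐ x ∂μ, x < (0 : ℝ) := by
      rw [ae_iff]
      simpa [Set.Ici] using hμ
    rw [← he.hasLaw.map_eq] at h1
    exact ae_of_ae_map he.hasLaw.aemeasurable h1
  filter_upwards [hneg, h.ae_started_zero] with ω hω h0
  by_contra! hpos
  have hle : hitTime (started ξ W) (above k) ω ≤ (0 : ℝ≥0) :=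
    hitTime_le_of_mem (by simpa [above, h0] using hpos)
  have hz : hitTime (started ξ W) (above k) ω = (0 : ℝ≥0) := le_antisymm hle bot_le
  rw [stoppedValue, hz] at hω
  exact hω.not_gt (by simpa [h0] using hpos)

lemma IsStartedBrownian.hitTime_wedge_ae_eq_below (h : IsStartedBrownian ξ W P) {kp km : ℝ}
    (hkp : 0 < kp) (hkm : km < 0) (hξ : ∀ᵐ ω ∂P, 0 ≤ ξ ω) :
    ∀ᵐ ω ∂P, hitTime (started ξ W) (wedge kp km) ω = hitTime (started ξ W) (below kp) ω := by
  filter_upwards [h.ae_continuous, h.ae_started_zero, h.ae_exists_zero_lt, hξ] with ω hc h0 hz hξ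
  exact hitTime_wedge_eq_below hkp hkm hc (h0 ▸ hξ) hz

lemma IsStartedBrownian.hitTime_wedge_ae_eq_above (h : IsStartedBrownian ξ W P) {kp km : ℝ}
    (hkp : 0 < kp) (hkm : km < 0) (hξ : ∀ᵐ ω ∂P, ξ ω ≤ 0) :
    ∀ᵐ ω ∂P, hitTime (started ξ W) (wedge kp km) ω = hitTime (started ξ W) (above km) ω := by
  filter_upwards [h.ae_continuous, h.ae_started_zero, h.ae_exists_zero_lt, hξ] with ω hc h0 hz hξ
  exact hitTime_wedge_eq_above hkp hkm hc (h0 ▸ hξ) hz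

/-- Regions that are almost surely hit at the same time yield the same stopped law. -/
lemma hasLaw_stoppedValue_congr {X : ℝ≥0 → Ω → ℝ} {D D' : Set (ℝ≥0 × ℝ)} {μ : Measure ℝ}
    (heq : ∀ᵐ ω ∂P, hitTime X D ω = hitTime X D' ω)
    (hD' : HasLaw (stoppedValue X (hitTime X D')) μ P) :
    HasLaw (stoppedValue X (hitTime X D)) μ P := by
  refine hD'.congr ?_
  filter_upwards [heq] with ω hω
  rw [stoppedValue, stoppedValue, hω]

lemma IsStartedBrownian.map_sampledValue (h : IsStartedBrownian ξ W P) {D : Set (ℝ≥0 × ℝ)}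
    (hD : IsOpen D) (hfin : ∀ᵐ ω ∂P, hitTime (started ξ W) D ω ≠ ⊤) :
    P.map (stoppedValue (started ξ W) (hitTime (started ξ W) D)) =
      (P.map (sampledPath ξ W)).map (sampledValue D) := by
  rw [Measure.map_congr (h.stoppedValue_ae_eq hD hfin), AEMeasurable.map_map_of_aemeasurable
    (measurable_sampledValue hD.measurableSet).aemeasurable h.aemeasurable_sampledPath]
  rfl

end Started

end SkorohodWedge

theorem proposition4
    {Ωp Ωm Ω : Type*} [MeasurableSpace Ωp] [MeasurableSpace Ωm] [MeasurableSpace Ω]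
    {Pp : Measure Ωp} {Pm : Measure Ωm} {P : Measure Ω}
    -- the target law and its positive and negative parts
    (μ μp μm : Measure ℝ) [IsProbabilityMeasure μ]
    [IsProbabilityMeasure μp] [IsProbabilityMeasure μm]
    (pp pm : ℝ≥0∞) (hpp : pp = μ (Set.Ici 0)) (hpm : pm = 1 - pp)
    (hμp : μp (Set.Iio 0) = 0) (hμm : μm (Set.Ici 0) = 0)
    (hμ : μ = pp • μp + pm • μm)
    -- the slopes
    (kp km : ℝ) (hkp : 0 < kp) (hkm : km < 0)
    -- the Brownian motions with random initial states
    (ξp : Ωp → ℝ) (Wp : ℝ≥0 → Ωp → ℝ) (hp : SkorohodWedge.IsStartedBrownian ξp Wp Pp)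
    (ξm : Ωm → ℝ) (Wm : ℝ≥0 → Ωm → ℝ) (hm : SkorohodWedge.IsStartedBrownian ξm Wm Pm)
    (ξ : Ω → ℝ) (W : ℝ≥0 → Ω → ℝ) (h : SkorohodWedge.IsStartedBrownian ξ W P)
    -- the two parts are embedded by the linear boundaries
    (hembp : SkorohodWedge.Embeds hp (SkorohodWedge.below kp) μp)
    (hembm : SkorohodWedge.Embeds hm (SkorohodWedge.above km) μm)
    -- the initial state is the mixture of the two initial states
    (hξ : HasLaw ξ (pp • Pp.map ξp + pm • Pm.map ξm) P) :
    SkorohodWedge.Embeds h (SkorohodWedge.wedge kp km) μ ∧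
      (SkorohodWedge.SolvesSkorohod hp (SkorohodWedge.below kp) μp →
        SkorohodWedge.SolvesSkorohod hm (SkorohodWedge.above km) μm →
        SkorohodWedge.SolvesSkorohod h (SkorohodWedge.wedge kp km) μ) := by
  have hD := SkorohodWedge.isOpen_wedge kp km
  have hmix := h.map_sampledPath_mixture hp hm hξ.map_eq
  have hEqp := hp.hitTime_wedge_ae_eq_below hkp hkm (hp.ae_nonneg_of_embeds_below hμp hembp)
  have hEqm := hm.hitTime_wedge_ae_eq_above hkp hkm (hm.ae_nonpos_of_embeds_above hμm hembm)
  have hfinp : ∀ᵐ ω ∂Pp, SkorohodWedge.hitTime (SkorohodWedge.started ξp Wp)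
      (SkorohodWedge.wedge kp km) ω ≠ ⊤ := by
    filter_upwards [hEqp, hembp.ae_finite] with ω h1 h2
    rwa [h1]
  have hfinm : ∀ᵐ ω ∂Pm, SkorohodWedge.hitTime (SkorohodWedge.started ξm Wm)
      (SkorohodWedge.wedge kp km) ω ≠ ⊤ := by
    filter_upwards [hEqm, hembm.ae_finite] with ω h1 h2
    rwa [h1]
  have hfin : ∀ᵐ ω ∂P, SkorohodWedge.hitTime (SkorohodWedge.started ξ W)
      (SkorohodWedge.wedge kp km) ω ≠ ⊤ := by
    -- Finiteness becomes a statement about path laws, which can be checked on each component.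
    rw [h.ae_finite_iff hD, hmix, ae_add_measure_iff]
    exact ⟨Measure.ae_smul_measure ((hp.ae_finite_iff hD).1 hfinp) _,
      Measure.ae_smul_measure ((hm.ae_finite_iff hD).1 hfinm) _⟩
  have hemb : SkorohodWedge.Embeds h (SkorohodWedge.wedge kp km) μ := by
    refine ⟨h.isStoppingTime_hitTime_wedge hkp hkm, hfin, ?_, ?_⟩
    · exact ((SkorohodWedge.measurable_sampledValue hD.measurableSet).comp_aemeasurable
        h.aemeasurable_sampledPath).congr (h.stoppedValue_ae_eq hD hfin).symm
    · have hlawp := (SkorohodWedge.hasLaw_stoppedValue_congr hEqp hembp.hasLaw).map_eq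
      have hlawm := (SkorohodWedge.hasLaw_stoppedValue_congr hEqm hembm.hasLaw).map_eq
      rw [hp.map_sampledValue hD hfinp] at hlawp
      rw [hm.map_sampledValue hD hfinm] at hlawm
      rw [h.map_sampledValue hD hfin, hmix,
        Measure.map_add _ _ (SkorohodWedge.measurable_sampledValue hD.measurableSet),
        Measure.map_smul, Measure.map_smul, hlawp, hlawm, ← hμ]
  refine ⟨hemb, fun hsp hsm ↦ ⟨hemb, ?_⟩⟩
  have hintp : ∫⁻ y, SkorohodWedge.sampledHitTime (SkorohodWedge.wedge kp km) y
      ∂Pp.map (SkorohodWedge.sampledPath ξp Wp) ≠ ⊤ := by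
    refine (hp.integrable_hitTime_iff hD hfinp).1 (hsp.integrable.congr ?_)
    filter_upwards [hEqp] with ω hω
    rw [hω]
  have hintm : ∫⁻ y, SkorohodWedge.sampledHitTime (SkorohodWedge.wedge kp km) y
      ∂Pm.map (SkorohodWedge.sampledPath ξm Wm) ≠ ⊤ := by
    refine (hm.integrable_hitTime_iff hD hfinm).1 (hsm.integrable.congr ?_)
    filter_upwards [hEqm] with ω hω
    rw [hω]
  have hpp_top : pp ≠ ⊤ := hpp ▸ measure_ne_top μ _
  have hpm_top : pm ≠ ⊤ := hpm ▸ ENNReal.sub_ne_top ENNReal.one_ne_top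
  rw [h.integrable_hitTime_iff hD hfin, hmix, lintegral_add_measure, lintegral_smul_measure,
    lintegral_smul_measure]
  exact ENNReal.add_ne_top.2 ⟨ENNReal.mul_ne_top hpp_top hintp, ENNReal.mul_ne_top hpm_top hintm⟩
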